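/- Let $\alpha,\beta,\omega,q,A_0,h_l>0$ and put $c=\frac{(1+q^2)\omega}{2q}$, $v=\frac{(1-q^2)\omega}{2q}$. Let $h_s$ and $h_g$ be independent real random variables, where $h_s$ has the Gamma-Gamma density $$f_{h_s}(x)=\frac{2(\alpha\beta)^{\frac{\alpha+\beta}{2}}}{\Gamma(\alpha)\Gamma(\beta)}\,x^{\frac{\alpha+\beta}{2}-1}K_{\alpha-\beta}\!\left(2\sqrt{\alpha\beta x}\right),\qquad x>0,$$ and $h_g$ has the density $$f_{h_g}(x)=\frac{\omega}{A_0}\left(\frac{x}{A_0}\right)^{\frac{(1+q^2)\omega}{2q}-1}I_0\!\left(-\frac{(1-q^2)\omega}{2q}\ln\frac{x}{A_0}\right),\qquad 0<x\le A_0,$$ both densities being zero elsewhere; here $I_0$ and $K_\nu$ are the modified Bessel functions of the first and second kind. Let $F_h$ be the cumulative distribution function of the end-to-end channel $h=h_l h_s h_g$. Then for every $x>0$ $$F_h(x)=\frac{\omega}{\Gamma(\alpha)\Gamma(\beta)}\sum_{k=0}^{\infty}\binom{2k}{k}\left(\frac v2\right)^{2k}G^{2k+3,\,1}_{2k+2,\,2k+4}\!\left(\frac{\alpha\beta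 x}{A_0h_l}\,\middle|\,\begin{matrix}1,\ \{c+1\}_1^{2k+1}\\ \alpha,\ \beta,\ \{c\}_1^{2k+1},\ 0\end{matrix}\right),$$ where $\{y\}_1^{N}$ means $y$ repeated $N$ times, the series converges absolutely, and the Meijer function is given by the absolutely convergent Mellin–Barnes integral $$G^{m,n}_{p,q'}\!\left(z\,\middle|\,\begin{matrix}a_1,\dots,a_p\\ b_1,\dots,b_{q'}\end{matrix}\right)=\frac1{2\pi i}\int_{\psi-i\infty}^{\psi+i\infty}\frac{\prod_{j=1}^m\Gamma(b_j-s)\prod_{j=1}^n\Gamma(1-a_j+s)}{\prod_{j=m+1}^{q'}\Gamma(1-b_j+s)\prod_{j=n+1}^{p}\Gamma(a_j-s)}\,z^s\,ds$$ along any vertical line $\operatorname{Re}s=\psi$ that has the poles of the $\Gamma(b_j-s)$, $j\le m$, on its right and those of the $\Gamma(1-a_j+s)$, $j\le n$, on its left (here $0<\psi<\min(\alpha,\beta,c)$). -/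

import Mathlib

open MeasureTheory ProbabilityTheory

/-- The modified Bessel function of the first kind of order zero,
`I₀(x) = ∑ₖ (x/2)^(2k) / (k!)²`. -/
noncomputable def besselI0 (x : ℝ) : ℝ :=
  ∑' k : ℕ, (x / 2) ^ (2 * k) / (k.factorial : ℝ) ^ 2

/-- The modified Bessel function of the second kind of real order `ν`, for `x > 0`,
`K_ν(x) = ∫₀^∞ exp (-x cosh t) cosh (ν t) dt`. -/
noncomputable def besselK (ν x : ℝ) : ℝ :=
  ∫ t in Set.Ioi (0 : ℝ), Real.exp (-x * Real.cosh t) * Real.cosh (ν * t)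

/-- The density of the geometric and misalignment loss `h_g`, supported on `[0, A₀]`
(the single point `0`, where the formula is singular, is left out). -/
noncomputable def pointingErrorPDF (ω q A₀ : ℝ) : ℝ → ℝ :=
  Set.indicator (Set.Ioc 0 A₀) fun x =>
    ω / A₀ * (x / A₀) ^ ((1 + q ^ 2) * ω / (2 * q) - 1) *
      besselI0 (-((1 - q ^ 2) * ω / (2 * q)) * Real.log (x / A₀))

/-- The Gamma-Gamma density of the turbulence factor `h_s`, supported on the positive reals. -/
noncomputable def gammaGammaPDF (α β : ℝ) : ℝ → ℝ :=
  Set.indicator (Set.Ioi 0) fun x =>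
    2 * (α * β) ^ ((α + β) / 2) / (Real.Gamma α * Real.Gamma β) *
      x ^ ((α + β) / 2 - 1) * besselK (α - β) (2 * Real.sqrt (α * β * x))

/-- `X` is a real random variable on `(Ω, P)` with density `f` (with respect to Lebesgue
measure). -/
def HasDensity {Ω : Type*} [MeasurableSpace Ω] (X : Ω → ℝ) (P : Measure Ω) (f : ℝ → ℝ) : Prop :=
  AEMeasurable X P ∧ P.map X = volume.withDensity fun x => ENNReal.ofReal (f x)

/-- The integrand of the Mellin–Barnes integral of the Meijer function `G^{m,n}_{p,q}(z | a; b)`,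
where `a` lists the `p` upper and `b` the `q` lower parameters:
`∏_{j ≤ m} Γ(b_j - s) ∏_{j ≤ n} Γ(1 - a_j + s) /
  (∏_{j > m} Γ(1 - b_j + s) ∏_{j > n} Γ(a_j - s)) * z ^ s`. -/
noncomputable def meijerIntegrand (m n : ℕ) (a b : List ℂ) (z s : ℂ) : ℂ :=
  (((b.take m).map fun x => Complex.Gamma (x - s)).prod *
      ((a.take n).map fun x => Complex.Gamma (1 - x + s)).prod) /
    (((b.drop m).map fun x => Complex.Gamma (1 - x + s)).prod *
      ((a.drop n).map fun x => Complex.Gamma (x - s)).prod) * z ^ s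

/-- The vertical line `Re s = ψ` has all poles of the factors `Γ(b_j - s)`, `j ≤ m`, on its right
and all poles of the factors `Γ(1 - a_j + s)`, `j ≤ n`, on its left. -/
def MeijerSeparates (m n : ℕ) (a b : List ℂ) (ψ : ℝ) : Prop :=
  (∀ x ∈ b.take m, ψ < x.re) ∧ (∀ x ∈ a.take n, x.re - 1 < ψ)

/-- `w` is the value at `z` of the Meijer function `G^{m,n}_{p,q}( · | a; b)` given by the
Mellin–Barnes integral `1/(2πi) ∫ ds` along a vertical line that separates the two families of
poles: there is such a line, and along every such line `s = ψ + i t` the integral converges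
absolutely and has the value `w`. -/
def HasMeijerG (m n : ℕ) (a b : List ℂ) (z w : ℂ) : Prop :=
  (∃ ψ : ℝ, MeijerSeparates m n a b ψ) ∧
    ∀ ψ : ℝ, MeijerSeparates m n a b ψ →
      Integrable (fun t : ℝ => meijerIntegrand m n a b z (ψ + t * Complex.I)) ∧
      1 / (2 * Real.pi * Complex.I) *
        ∫ t : ℝ, meijerIntegrand m n a b z (ψ + t * Complex.I) * Complex.I = w

open Classical in
/-- The Meijer function `G^{m,n}_{p,q}(z | a; b)` with `p = a.length` and `q = b.length`, defined
by its Mellin–Barnes integral along a separating vertical line (and `0` when that integral does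
not define a value). -/
noncomputable def meijerG (m n : ℕ) (a b : List ℂ) (z : ℂ) : ℂ :=
  if h : ∃ w, HasMeijerG m n a b z w then h.choose else 0

theorem HasMeijerG.meijerG_eq {m n : ℕ} {a b : List ℂ} {z w : ℂ}
    (hw : HasMeijerG m n a b z w) : meijerG m n a b z = w := by
  have h : ∃ w, HasMeijerG m n a b z w := ⟨w, hw⟩
  obtain ⟨ψ, hψ⟩ := hw.1
  rw [meijerG, dif_pos h, ← (h.choose_spec.2 ψ hψ).2, (hw.2 ψ hψ).2]

/-!
The product `h = h_l h_s h_g` is decomposed into gamma variables. The density of `h_s` is the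
multiplicative convolution of two gamma densities (`withDensity_gammaGammaPDF`), so `h_s` is
distributed as the product of independent gamma variables of shapes `α` and `β` and mean one.
Expanding `I₀` in its power series shows that `h_g` is distributed as `A₀ e⁻ᵀ`, where `T` follows a
mixture of gamma laws of shapes `2k + 1` and rate `c`, with weights proportional to
`(2k choose k) (v / 2c) ^ (2k)` (`withDensity_pointingErrorPDF`). Conditioning on the component of
the mixture, the distribution function of `h` is a convergent series, with nonnegative terms, of
distribution functions of the variables `h_l A₀ U`, where `U = h_s e^{-T_k}`.

Each of these is a Meijer function (`hasMeijerG_gammaGamma`). The Mellin transform of `z ↦ P(U ≤ z)`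
at `-s` is `E[U⁻ˢ] / s`, by Fubini (`hasMellin_measureReal_Iic`), and the moment `E[U⁻ˢ]` is
explicit: it is a constant times `(αβ)ˢ Γ(α - s) Γ(β - s) / (c - s) ^ (2k + 1)`. The gamma quotients
in the Mellin–Barnes integrand collapse to `E[U⁻ˢ] / s` as well (`meijerIntegrand_eq`), so the claim
is Mellin inversion. The inversion theorem applies because, on a vertical line, the moments of `h_s`
are bounded and `1 / (s (c - s) ^ (2k + 1))` decays at least quadratically
(`integrable_mellin_gammaGamma_mconv`); no asymptotics of the gamma function are needed.
-/

section

open Set Filter Topology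

/-! ### Mellin inversion for distribution functions -/

lemma integral_Ici_cpow_neg_sub_one {s : ℂ} (hs : 0 < s.re) {u : ℝ} (hu : 0 < u) :
    ∫ z in Ici u, (z : ℂ) ^ (-s - 1) = (u : ℂ) ^ (-s) / s := by
  have hs0 : s ≠ 0 := by rintro rfl; simp at hs
  rw [integral_Ici_eq_integral_Ioi, integral_Ioi_cpow_of_lt (by simpa using by linarith) hu]
  simp [neg_div_neg_eq]

lemma integrable_mellin_kernel {τ : Measure ℝ} [IsProbabilityMeasure τ]
    (hτ : ∀ᵐ u ∂τ, 0 < u) {s : ℂ} (hs : 0 < s.re)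
    (hint : Integrable (fun u : ℝ => u ^ (-s.re)) τ) :
    Integrable (fun p : ℝ × ℝ => (Ici p.2).indicator (fun z : ℝ => (z : ℂ) ^ (-s - 1)) p.1)
      ((volume.restrict (Ioi 0)).prod τ) := by
  have hmeas : Measurable
      (fun p : ℝ × ℝ => (Ici p.2).indicator (fun z : ℝ => (z : ℂ) ^ (-s - 1)) p.1) := by
    have h : Measurable fun p : ℝ × ℝ => (p.1 : ℂ) ^ (-s - 1) := by fun_prop
    exact h.indicator (measurableSet_le measurable_snd measurable_fst)
  have hsub : ∀ u : ℝ, 0 < u → Ici u ∩ Ioi 0 = Ici u := fun u hu =>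
    inter_eq_left.2 fun z hz => hu.trans_le hz
  refine (integrable_prod_iff' hmeas.aestronglyMeasurable).2 ⟨?_, ?_⟩
  · filter_upwards [hτ] with u hu
    rw [integrable_indicator_iff measurableSet_Ici, IntegrableOn,
      Measure.restrict_restrict measurableSet_Ici, hsub u hu, ← IntegrableOn,
      integrableOn_Ici_iff_integrableOn_Ioi]
    exact integrableOn_Ioi_cpow_of_lt (by simpa using by linarith) hu
  · refine (hint.div_const s.re).congr ?_
    filter_upwards [hτ] with u hu
    simp_rw [norm_indicator_eq_indicator_norm]
    rw [integral_indicator measurableSet_Ici, Measure.restrict_restrict measurableSet_Ici,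
      hsub u hu]
    have : ∀ z ∈ Ici u, ‖(z : ℂ) ^ (-s - 1)‖ = z ^ (-s.re - 1) := fun z hz => by
      rw [Complex.norm_cpow_eq_rpow_re_of_pos (hu.trans_le hz)]; simp
    rw [setIntegral_congr_fun measurableSet_Ici this, integral_Ici_eq_integral_Ioi,
      integral_Ioi_rpow_of_lt (by linarith) hu]
    simp [neg_div_neg_eq]

lemma integral_mellin_kernel_right (τ : Measure ℝ) [IsProbabilityMeasure τ] (s : ℂ) (z : ℝ) :
    ∫ u, (Ici u).indicator (fun z : ℝ => (z : ℂ) ^ (-s - 1)) z ∂τ =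
      (z : ℂ) ^ (-s - 1) • (τ.real (Iic z) : ℂ) := by
  have : (fun u => (Ici u).indicator (fun z : ℝ => (z : ℂ) ^ (-s - 1)) z) =
      (Iic z).indicator fun _ => (z : ℂ) ^ (-s - 1) := by
    ext u; simp [indicator_apply]
  rw [this, integral_indicator measurableSet_Iic, setIntegral_const]
  simp [mul_comm]

/-- The cumulative distribution function of a law on the positive half-line has, at `-s` with
`0 < Re s`, the Mellin transform `E[u⁻ˢ] / s`: this is Fubini's theorem for
`z⁻ˢ⁻¹ · 1_{u ≤ z}`. -/
lemma hasMellin_measureReal_Iic {τ : Measure ℝ} [IsProbabilityMeasure τ]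
    (hτ : ∀ᵐ u ∂τ, 0 < u) {s : ℂ} (hs : 0 < s.re)
    (hint : Integrable (fun u : ℝ => u ^ (-s.re)) τ) :
    HasMellin (fun z => (τ.real (Iic z) : ℂ)) (-s) ((∫ u, (u : ℂ) ^ (-s) ∂τ) / s) := by
  have hK := integrable_mellin_kernel hτ hs hint
  constructor
  · refine hK.integral_prod_left.congr (ae_of_all _ fun z => ?_)
    exact integral_mellin_kernel_right τ s z
  · have := integral_integral_swap (f := fun z u =>
      (Ici u).indicator (fun z : ℝ => (z : ℂ) ^ (-s - 1)) z) hK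
    simp_rw [integral_mellin_kernel_right] at this
    rw [mellin, this, ← integral_div]
    refine integral_congr_ae ?_
    filter_upwards [hτ] with u hu
    rw [integral_indicator measurableSet_Ici, Measure.restrict_restrict measurableSet_Ici,
      inter_eq_left.2 (show Ici u ⊆ Ioi 0 from fun z hz => hu.trans_le hz),
      integral_Ici_cpow_neg_sub_one hs hu]

lemma continuousAt_measureReal_Iic {τ : Measure ℝ} [IsProbabilityMeasure τ] {x : ℝ}
    (hx : τ {x} = 0) : ContinuousAt (fun z => τ.real (Iic z)) x := by
  have hrep : (fun z => τ.real (Iic z)) = fun z => ∫ u, (Iic z).indicator (1 : ℝ → ℝ) u ∂τ := by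
    ext z; rw [integral_indicator_one measurableSet_Iic]
  rw [hrep]
  refine continuousAt_of_dominated (bound := fun _ => 1) ?_ ?_ (integrable_const _) ?_
  · exact Eventually.of_forall fun z =>
      (measurable_one.indicator measurableSet_Iic).aestronglyMeasurable
  · refine Eventually.of_forall fun z => ae_of_all _ fun u => ?_
    by_cases h : u ∈ Iic z <;> simp [h]
  · have : ∀ᵐ u ∂τ, u ≠ x := by simpa [ae_iff] using hx
    filter_upwards [this] with u hu
    rcases lt_or_gt_of_ne hu with h | h
    · refine (continuousAt_const (y := (1 : ℝ))).congr ?_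
      filter_upwards [lt_mem_nhds h] with z hz
      simp [hz.le]
    · refine (continuousAt_const (y := (0 : ℝ))).congr ?_
      filter_upwards [gt_mem_nhds h] with z hz
      simp [hz]

/-- Mellin inversion for a cumulative distribution function on the positive half-line. -/
lemma integral_mellin_eq_measureReal_Iic {τ : Measure ℝ} [IsProbabilityMeasure τ]
    (hτ : ∀ᵐ u ∂τ, 0 < u) {x ψ : ℝ} (hx : 0 < x) (hψ : 0 < ψ) (hatom : τ {x} = 0)
    (hint : Integrable (fun u : ℝ => u ^ (-ψ)) τ)
    (hV : Integrable fun t : ℝ => (∫ u, (u : ℂ) ^ (-(ψ + t * Complex.I)) ∂τ) /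
      (ψ + t * Complex.I)) :
    1 / (2 * Real.pi) * ∫ t : ℝ, (∫ u, (u : ℂ) ^ (-(ψ + t * Complex.I)) ∂τ) /
      (ψ + t * Complex.I) * (x : ℂ) ^ (ψ + t * Complex.I) = (τ.real (Iic x) : ℂ) := by
  set f : ℝ → ℂ := fun z => (τ.real (Iic z) : ℂ)
  have hM : ∀ t : ℝ, HasMellin f (-(ψ + t * Complex.I))
      ((∫ u, (u : ℂ) ^ (-(ψ + t * Complex.I)) ∂τ) / (ψ + t * Complex.I)) := fun t =>
    hasMellin_measureReal_Iic hτ (by simpa using hψ) (by simpa using hint)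
  have hV' : Complex.VerticalIntegrable (mellin f) (-ψ : ℝ) := by
    refine hV.comp_neg.congr (ae_of_all _ fun t => ?_)
    have := (hM (-t)).2
    push_cast at this ⊢
    simp only [← this]
    congr 1
    ring
  have h0 : MellinConvergent f ((-ψ : ℝ) : ℂ) := by simpa using (hM 0).1
  have hc : ContinuousAt f x :=
    Complex.continuous_ofReal.continuousAt.comp (continuousAt_measureReal_Iic hatom)
  have := mellinInv_mellin_eq (-ψ) f hx h0 hV' hc
  rw [← show f x = (τ.real (Iic x) : ℂ) from rfl, ← this, mellinInv,
    ← integral_neg_eq_self]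
  rw [Complex.real_smul]
  push_cast
  congr 1
  refine integral_congr_ae (ae_of_all _ fun t => ?_)
  have h := (hM (-t)).2
  push_cast at h
  simp only [smul_eq_mul]
  rw [← h, mul_comm]
  congr 2 <;> ring

/-! ### Moments of gamma laws -/

@[fun_prop]
lemma measurable_gammaPDF (a r : ℝ) : Measurable (gammaPDF a r) :=
  (measurable_gammaPDFReal a r).ennreal_ofReal

lemma toReal_gammaPDF {a r : ℝ} (ha : 0 < a) (hr : 0 < r) (x : ℝ) :
    (gammaPDF a r x).toReal = gammaPDFReal a r x :=
  ENNReal.toReal_ofReal (gammaPDFReal_nonneg ha hr x)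

lemma ae_pos_gammaMeasure (a r : ℝ) : ∀ᵐ x ∂gammaMeasure a r, 0 < x := by
  have h0 : ∀ᵐ x : ℝ, x ≠ 0 := by simp [ae_iff]
  rw [gammaMeasure, ae_withDensity_iff (measurable_gammaPDF a r)]
  filter_upwards [h0] with x hx h
  by_contra hneg
  exact h (gammaPDF_of_neg (lt_of_le_of_ne (not_lt.1 hneg) hx))

lemma integral_gammaMeasure {a r : ℝ} (ha : 0 < a) (hr : 0 < r) (f : ℝ → ℂ) :
    ∫ x, f x ∂gammaMeasure a r = ((r ^ a / Real.Gamma a : ℝ) : ℂ) *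
      ∫ x in Ioi (0 : ℝ), (x : ℂ) ^ ((a : ℂ) - 1) * Complex.exp (-(r * x)) * f x := by
  rw [gammaMeasure, integral_withDensity_eq_integral_toReal_smul
    (measurable_gammaPDF a r) (ae_of_all _ fun x => ENNReal.ofReal_lt_top),
    ← integral_const_mul, ← integral_Ici_eq_integral_Ioi, ← integral_indicator measurableSet_Ici]
  refine integral_congr_ae ?_
  filter_upwards with x
  rw [toReal_gammaPDF ha hr, Complex.real_smul]
  by_cases hx : 0 ≤ x
  · rw [gammaPDFReal, if_pos hx, indicator_of_mem (mem_Ici.2 hx)]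
    push_cast [Complex.ofReal_cpow hx]
    ring
  · rw [gammaPDFReal, if_neg hx, indicator_of_notMem (by simpa using hx)]
    simp

lemma integrable_gammaMeasure_iff {a r : ℝ} (ha : 0 < a) (hr : 0 < r) (f : ℝ → ℝ) :
    Integrable f (gammaMeasure a r) ↔
      IntegrableOn (fun x => x ^ (a - 1) * Real.exp (-(r * x)) * f x) (Ioi 0) := by
  have hne : r ^ a / Real.Gamma a ≠ 0 := by positivity
  rw [gammaMeasure, integrable_withDensity_iff_integrable_smul'
    (measurable_gammaPDF a r) (ae_of_all _ fun x => ENNReal.ofReal_lt_top),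
    ← integrableOn_Ici_iff_integrableOn_Ioi, ← integrable_indicator_iff measurableSet_Ici,
    ← integrable_const_mul_iff hne.isUnit ((Ici 0).indicator _)]
  refine integrable_congr (ae_of_all _ fun x => ?_)
  simp only [toReal_gammaPDF ha hr]
  by_cases hx : 0 ≤ x
  · rw [gammaPDFReal, if_pos hx, indicator_of_mem (mem_Ici.2 hx), smul_eq_mul]
    ring
  · rw [gammaPDFReal, if_neg hx, indicator_of_notMem (by simpa using hx)]
    simp

lemma integrableOn_rpow_mul_exp_neg_mul {b r : ℝ} (hb : -1 < b) (hr : 0 < r) :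
    IntegrableOn (fun x : ℝ => x ^ b * Real.exp (-(r * x))) (Ioi 0) := by
  simpa using integrableOn_rpow_mul_exp_neg_mul_rpow hb one_pos hr

lemma integrable_rpow_neg_gammaMeasure {a r ψ : ℝ} (ha : 0 < a) (hr : 0 < r) (hψ : ψ < a) :
    Integrable (fun x : ℝ => x ^ (-ψ)) (gammaMeasure a r) := by
  rw [integrable_gammaMeasure_iff ha hr]
  refine (integrableOn_rpow_mul_exp_neg_mul (b := a - ψ - 1) (by linarith) hr).congr_fun
    (fun x (hx : 0 < x) => ?_) measurableSet_Ioi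
  simp only
  rw [mul_right_comm, ← Real.rpow_add hx]
  ring_nf

/-- The complex moments of negative order of a gamma law. -/
lemma integral_cpow_neg_gammaMeasure {a r : ℝ} (ha : 0 < a) (hr : 0 < r) {s : ℂ}
    (hs : s.re < a) :
    ∫ x, (x : ℂ) ^ (-s) ∂gammaMeasure a r =
      (r : ℂ) ^ s * Complex.Gamma (a - s) / Real.Gamma a := by
  have hr' : (r : ℂ) ≠ 0 := by exact_mod_cast hr.ne'
  rw [integral_gammaMeasure ha hr]
  have : ∀ x ∈ Ioi (0 : ℝ), (x : ℂ) ^ ((a : ℂ) - 1) * Complex.exp (-(r * x)) * (x : ℂ) ^ (-s) =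
      (x : ℂ) ^ ((a : ℂ) - s - 1) * Complex.exp (-(r * x)) := fun x (hx : 0 < x) => by
    rw [mul_right_comm, ← Complex.cpow_add _ _ (by exact_mod_cast hx.ne')]
    ring_nf
  rw [setIntegral_congr_fun measurableSet_Ioi this,
    Complex.integral_cpow_mul_exp_neg_mul_Ioi (by simpa using hs) hr, one_div,
    Complex.inv_cpow _ _ (by simp [Complex.arg_ofReal_of_nonneg hr.le, Real.pi_ne_zero.symm]),
    ← Complex.cpow_neg, neg_sub, Complex.cpow_sub _ _ hr']
  push_cast [Complex.ofReal_cpow hr.le]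
  have : (r : ℂ) ^ (a : ℂ) ≠ 0 := by simp [Complex.cpow_eq_zero_iff, hr']
  field_simp

lemma integrableOn_pow_mul_cexp_neg_mul (n : ℕ) {a : ℂ} (ha : 0 < a.re) :
    IntegrableOn (fun t : ℝ => (t : ℂ) ^ n * Complex.exp (-(a * t))) (Ioi 0) := by
  refine Integrable.mono'
    (integrableOn_rpow_mul_exp_neg_mul (b := n) (by linarith [n.cast_nonneg (α := ℝ)]) ha)
    (by fun_prop) ?_
  filter_upwards [ae_restrict_mem measurableSet_Ioi] with t ht
  simp [Complex.norm_exp, abs_of_pos (mem_Ioi.1 ht)]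

/-- Laplace transform of a power, with a complex argument. -/
lemma integral_pow_mul_cexp_neg_mul (n : ℕ) {a : ℂ} (ha : 0 < a.re) :
    ∫ t in Ioi (0 : ℝ), (t : ℂ) ^ n * Complex.exp (-(a * t)) = n.factorial / a ^ (n + 1) := by
  have ha0 : a ≠ 0 := by rintro rfl; simp at ha
  induction n with
  | zero =>
    have := integral_exp_mul_complex_Ioi (a := -a) (by simpa using ha) 0
    simpa [neg_div_neg_eq] using this
  | succ n ih =>
    have hd : ∀ t ∈ Ici (0 : ℝ), HasDerivAt
        (fun t : ℝ => (t : ℂ) ^ (n + 1) * Complex.exp (-(a * t)))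
        ((n + 1) * ((t : ℂ) ^ n * Complex.exp (-(a * t))) -
          a * ((t : ℂ) ^ (n + 1) * Complex.exp (-(a * t)))) t := fun t _ => by
      have h1 : HasDerivAt (fun z : ℂ => z ^ (n + 1) * Complex.exp (-(a * z)))
          (((n + 1 : ℕ) : ℂ) * (t : ℂ) ^ n * Complex.exp (-(a * t)) +
            (t : ℂ) ^ (n + 1) * (Complex.exp (-(a * t)) * -(a * 1))) t :=
        (hasDerivAt_pow (n + 1) (t : ℂ)).mul (((hasDerivAt_id _).const_mul a).neg.cexp)
      convert! h1.comp_ofReal using 1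
      push_cast
      ring
    have hlim : Tendsto (fun t : ℝ => (t : ℂ) ^ (n + 1) * Complex.exp (-(a * t))) atTop (𝓝 0) := by
      rw [tendsto_zero_iff_norm_tendsto_zero]
      refine (tendsto_rpow_mul_exp_neg_mul_atTop_nhds_zero (n + 1 : ℕ) a.re ha).congr' ?_
      filter_upwards [eventually_gt_atTop 0] with t ht
      rw [Real.rpow_natCast]
      simp [Complex.norm_exp, abs_of_pos ht]
    have h1 := (integrableOn_pow_mul_cexp_neg_mul n ha).const_mul (n + 1 : ℂ)
    have h2 := (integrableOn_pow_mul_cexp_neg_mul (n + 1) ha).const_mul a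
    have := integral_Ioi_of_hasDerivAt_of_tendsto' hd (h1.sub h2) hlim
    rw [integral_sub h1 h2, integral_const_mul, integral_const_mul, ih] at this
    simp only [Complex.ofReal_zero, ne_eq, Nat.add_eq_zero_iff, one_ne_zero, and_false,
      not_false_eq_true, zero_pow, zero_mul, sub_zero, sub_eq_zero] at this
    rw [eq_div_iff (pow_ne_zero _ ha0), pow_succ, mul_comm (a ^ (n + 1)) a, ← mul_assoc,
      mul_comm _ a, ← this, Nat.factorial_succ]
    push_cast
    field_simp

/-- The complex exponential moments of a gamma law with integral shape parameter. -/
lemma integral_cexp_gammaMeasure (n : ℕ) {c : ℝ} (hc : 0 < c) {s : ℂ} (hs : s.re < c) :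
    ∫ t, Complex.exp (s * t) ∂gammaMeasure (n + 1 : ℕ) c = (c / (c - s)) ^ (n + 1) := by
  have hcs : (c : ℂ) - s ≠ 0 := by
    intro h
    have := congrArg Complex.re h
    simp only [Complex.sub_re, Complex.ofReal_re, Complex.zero_re] at this
    linarith
  rw [integral_gammaMeasure (by positivity) hc]
  have : ∀ t ∈ Ioi (0 : ℝ), (t : ℂ) ^ ((((n + 1 : ℕ) : ℝ) : ℂ) - 1) * Complex.exp (-(c * t)) *
      Complex.exp (s * t) = (t : ℂ) ^ n * Complex.exp (-((c - s) * t)) := fun t ht => by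
    rw [mul_assoc, ← Complex.exp_add]
    push_cast
    rw [add_sub_cancel_right, Complex.cpow_natCast]
    ring_nf
  rw [setIntegral_congr_fun measurableSet_Ioi this,
    integral_pow_mul_cexp_neg_mul n (by simpa using hs)]
  rw [Real.rpow_natCast, Nat.cast_succ, Real.Gamma_nat_eq_factorial]
  have : (n.factorial : ℂ) ≠ 0 := by exact_mod_cast n.factorial_ne_zero
  rw [div_pow]
  push_cast
  field_simp

lemma integrable_exp_gammaMeasure {a c ψ : ℝ} (ha : 0 < a) (hc : 0 < c) (hψ : ψ < c) :
    Integrable (fun t : ℝ => Real.exp (ψ * t)) (gammaMeasure a c) := by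
  rw [integrable_gammaMeasure_iff ha hc]
  refine (integrableOn_rpow_mul_exp_neg_mul (b := a - 1) (r := c - ψ) (by linarith)
    (by linarith)).congr_fun (fun x (hx : 0 < x) => ?_) measurableSet_Ioi
  simp only
  rw [mul_assoc, ← Real.exp_add]
  ring_nf

/-! ### The Gamma-Gamma law -/

lemma sq_div_four_le_cosh (t : ℝ) : t ^ 2 / 4 ≤ Real.cosh t := by
  have h := Real.quadratic_le_exp_of_nonneg (abs_nonneg t)
  rw [sq_abs] at h
  rw [← Real.cosh_abs, Real.cosh_eq]
  have := Real.exp_pos (-|t|)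
  have := abs_nonneg t
  linarith

lemma integrable_exp_neg_mul_cosh_mul_exp (ν : ℝ) {x : ℝ} (hx : 0 < x) :
    Integrable fun t : ℝ => Real.exp (-x * Real.cosh t) * Real.exp (ν * t) := by
  have hb : (((-(x / 4) : ℝ) : ℂ)).re < 0 := by
    rw [Complex.ofReal_re]; linarith
  refine (integrable_cexp_quadratic' hb ν 0).norm.mono' (by fun_prop) (ae_of_all _ fun t => ?_)
  rw [← Real.exp_add, Real.norm_eq_abs, Real.abs_exp, Complex.norm_exp]
  refine Real.exp_le_exp.2 ?_
  have := mul_le_mul_of_nonneg_left (sq_div_four_le_cosh t) hx.le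
  have hre : (((-(x / 4) : ℝ) : ℂ) * (t : ℂ) ^ 2 + (ν : ℂ) * (t : ℂ) + 0).re =
      -(x / 4) * t ^ 2 + ν * t := by
    rw [add_zero]; norm_cast
  rw [hre]
  linarith

/-- The two-sided exponential form of the integral defining `K_ν`. -/
lemma integral_exp_neg_mul_cosh_mul_exp (ν : ℝ) {x : ℝ} (hx : 0 < x) :
    ∫ t : ℝ, Real.exp (-x * Real.cosh t) * Real.exp (ν * t) = 2 * besselK ν x := by
  have hI := integrable_exp_neg_mul_cosh_mul_exp ν hx
  have hI' := integrable_exp_neg_mul_cosh_mul_exp (-ν) hx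
  have hneg : ∫ t : ℝ, Real.exp (-x * Real.cosh t) * Real.exp (-ν * t) =
      ∫ t : ℝ, Real.exp (-x * Real.cosh t) * Real.exp (ν * t) := by
    rw [← integral_neg_eq_self]
    simp
  have habs := integral_comp_abs
    (f := fun t : ℝ => Real.exp (-x * Real.cosh t) * Real.cosh (ν * t))
  have hcosh : ∀ t : ℝ, Real.exp (-x * Real.cosh |t|) * Real.cosh (ν * |t|) =
      2⁻¹ * (Real.exp (-x * Real.cosh t) * Real.exp (ν * t) +
        Real.exp (-x * Real.cosh t) * Real.exp (-ν * t)) := fun t => by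
    have : Real.cosh (ν * |t|) = Real.cosh (ν * t) := by
      rcases abs_cases t with ⟨h, -⟩ | ⟨h, -⟩ <;> simp [h]
    rw [Real.cosh_abs, this, Real.cosh_eq (ν * t)]
    ring_nf
  simp_rw [hcosh] at habs
  rw [integral_const_mul, integral_add hI hI', hneg] at habs
  rw [besselK, ← habs]
  ring

/-- The two gamma densities along `p = √(βx/α) eᵗ`, where the exponents combine to a hyperbolic
cosine. -/
lemma gammaPDFReal_mul_gammaPDFReal_div {α β x k : ℝ} (hα : 0 < α) (hβ : 0 < β) (hx : 0 < x)
    (hk : k = Real.sqrt (β * x / α)) (t : ℝ) :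
    gammaPDFReal α α (k * Real.exp t) * gammaPDFReal β β (x / (k * Real.exp t)) =
      (α * β) ^ ((α + β) / 2) / (Real.Gamma α * Real.Gamma β) * x ^ ((α + β) / 2 - 1) *
        (Real.exp (-(2 * Real.sqrt (α * β * x)) * Real.cosh t) * Real.exp ((α - β) * t)) := by
  have hk0 : 0 < k := hk ▸ Real.sqrt_pos.2 (by positivity)
  have hlogk : Real.log k = (Real.log β + Real.log x - Real.log α) / 2 := by
    rw [hk, Real.log_sqrt (by positivity), Real.log_div (by positivity) hα.ne',
      Real.log_mul hβ.ne' hx.ne']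
  have hαk : α * k = Real.sqrt (α * β * x) := by
    rw [hk, ← Real.sqrt_sq hα.le, ← Real.sqrt_mul (by positivity), Real.sqrt_sq hα.le]
    congr 1
    field_simp
  have hβk : β * (x / (k * Real.exp t)) = Real.sqrt (α * β * x) * Real.exp (-t) := by
    have hk2 : k ^ 2 = β * x / α := by rw [hk, Real.sq_sqrt (by positivity)]
    rw [← hαk, Real.exp_neg]
    rw [eq_div_iff hα.ne'] at hk2
    field_simp
    linarith
  have hp : 0 < k * Real.exp t := by positivity
  have hq : 0 < x / (k * Real.exp t) := by positivity
  rw [gammaPDFReal, gammaPDFReal, if_pos hp.le, if_pos hq.le, hβk, ← mul_assoc α, hαk,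
    Real.cosh_eq]
  set w := Real.sqrt (α * β * x)
  rw [Real.rpow_def_of_pos hα, Real.rpow_def_of_pos hβ, Real.rpow_def_of_pos hp,
    Real.rpow_def_of_pos hq, Real.rpow_def_of_pos (mul_pos hα hβ), Real.rpow_def_of_pos hx,
    Real.log_div hx.ne' hp.ne', Real.log_mul hk0.ne' (Real.exp_pos t).ne', Real.log_exp,
    Real.log_mul hα.ne' hβ.ne', hlogk]
  have hΓα := (Real.Gamma_pos_of_pos hα).ne'
  have hΓβ := (Real.Gamma_pos_of_pos hβ).ne'
  field_simp
  simp only [← Real.exp_add]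
  congr 1
  ring

/-- The Gamma-Gamma density as the multiplicative convolution of two gamma densities. -/
lemma lintegral_gammaPDF_mul_gammaPDF_div {α β x : ℝ} (hα : 0 < α) (hβ : 0 < β) (hx : 0 < x) :
    ∫⁻ p in Ioi (0 : ℝ), gammaPDF α α p * (ENNReal.ofReal p⁻¹ * gammaPDF β β (x / p)) =
      ENNReal.ofReal (gammaGammaPDF α β x) := by
  set k := Real.sqrt (β * x / α) with hk
  have hk0 : 0 < k := Real.sqrt_pos.2 (by positivity)
  -- The substitution `p = k eᵗ` turns `dp / p` into `dt`.
  have himg : (fun t => k * Real.exp t) '' univ = Ioi 0 := by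
    rw [image_univ]
    ext p
    constructor
    · rintro ⟨t, rfl⟩
      exact mul_pos hk0 (Real.exp_pos t)
    · intro hp
      refine ⟨Real.log (p / k), ?_⟩
      simp only
      rw [Real.exp_log (div_pos hp hk0), mul_div_cancel₀ _ hk0.ne']
  have hinj : InjOn (fun t => k * Real.exp t) univ := fun a _ b _ hab =>
    Real.exp_injective (mul_left_cancel₀ hk0.ne' hab)
  rw [← himg, lintegral_image_eq_lintegral_abs_deriv_mul MeasurableSet.univ
    (fun t _ => ((Real.hasDerivAt_exp t).const_mul k).hasDerivWithinAt) hinj,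
    Measure.restrict_univ]
  have hI := integrable_exp_neg_mul_cosh_mul_exp (α - β)
    (x := 2 * Real.sqrt (α * β * x)) (by positivity)
  have hC : 0 ≤ (α * β) ^ ((α + β) / 2) / (Real.Gamma α * Real.Gamma β) *
      x ^ ((α + β) / 2 - 1) := by positivity
  rw [gammaGammaPDF, indicator_of_mem (mem_Ioi.2 hx)]
  have hrhs : 2 * (α * β) ^ ((α + β) / 2) / (Real.Gamma α * Real.Gamma β) *
      x ^ ((α + β) / 2 - 1) * besselK (α - β) (2 * Real.sqrt (α * β * x)) =
      ∫ t, (α * β) ^ ((α + β) / 2) / (Real.Gamma α * Real.Gamma β) * x ^ ((α + β) / 2 - 1) *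
        (Real.exp (-(2 * Real.sqrt (α * β * x)) * Real.cosh t) * Real.exp ((α - β) * t)) := by
    rw [integral_const_mul, integral_exp_neg_mul_cosh_mul_exp _ (by positivity)]
    ring
  rw [hrhs, ofReal_integral_eq_lintegral_ofReal (hI.const_mul _)
    (ae_of_all _ fun t => by positivity)]
  refine lintegral_congr fun t => ?_
  have hp : 0 < k * Real.exp t := by positivity
  rw [← gammaPDFReal_mul_gammaPDFReal_div hα hβ hx hk, abs_of_pos hp,
    ENNReal.ofReal_mul (gammaPDFReal_nonneg hα hα _), gammaPDF, gammaPDF,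
    mul_left_comm, ← mul_assoc (ENNReal.ofReal (k * Real.exp t)), ← ENNReal.ofReal_mul hp.le,
    mul_inv_cancel₀ hp.ne']
  simp

lemma gammaMeasure_preimage_mul_left (a r : ℝ) {p : ℝ} (hp : 0 < p) {s : Set ℝ}
    (hs : MeasurableSet s) :
    gammaMeasure a r ((p * ·) ⁻¹' s) =
      ∫⁻ x in s, ENNReal.ofReal p⁻¹ * gammaPDF a r (x / p) := by
  have hd : Measurable fun x : ℝ => gammaPDF a r (x / p) := by fun_prop
  rw [gammaMeasure, withDensity_apply _ (hs.preimage (measurable_const_mul p)),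
    lintegral_const_mul _ hd,
    ← lintegral_indicator hs, ← lintegral_indicator (hs.preimage (measurable_const_mul p)),
    ← abs_of_pos (inv_pos.2 hp), ← smul_eq_mul, ← lintegral_smul_measure,
    ← Real.map_volume_mul_left hp.ne', lintegral_map (hd.indicator hs) (measurable_const_mul p)]
  refine lintegral_congr fun x => ?_
  simp only [indicator, mul_div_cancel_left₀ _ hp.ne']
  rfl

/-- The Gamma-Gamma law is the law of the product of two independent gamma variables of mean one,
with shape parameters `α` and `β`. -/
lemma withDensity_gammaGammaPDF {α β : ℝ} (hα : 0 < α) (hβ : 0 < β) :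
    volume.withDensity (fun x => ENNReal.ofReal (gammaGammaPDF α β x)) =
      gammaMeasure α α ∗ₘ gammaMeasure β β := by
  have := isProbabilityMeasure_gammaMeasure hα hα
  have := isProbabilityMeasure_gammaMeasure hβ hβ
  ext s hs
  have hm : Measurable fun q : ℝ × ℝ =>
      gammaPDF α α q.1 * (ENNReal.ofReal q.1⁻¹ * gammaPDF β β (q.2 / q.1)) := by
    fun_prop
  rw [Measure.mconv, Measure.map_apply (by fun_prop) hs,
    Measure.prod_apply (hs.preimage (by fun_prop)), withDensity_apply _ hs]
  have hsec : (fun p : ℝ => gammaMeasure β β (Prod.mk p ⁻¹' ((fun p => p.1 * p.2) ⁻¹' s)))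
      =ᵐ[gammaMeasure α α] fun p => ∫⁻ x in s, ENNReal.ofReal p⁻¹ * gammaPDF β β (x / p) := by
    filter_upwards [ae_pos_gammaMeasure α α] with p hp
    exact gammaMeasure_preimage_mul_left β β hp hs
  have hpos : (gammaMeasure α α).restrict (Ioi 0) = gammaMeasure α α :=
    Measure.restrict_eq_self_of_ae_mem (ae_pos_gammaMeasure α α)
  have hmi : Measurable fun p => ∫⁻ x in s, ENNReal.ofReal p⁻¹ * gammaPDF β β (x / p) := by
    refine Measurable.lintegral_prod_right' (f := fun q : ℝ × ℝ =>
      ENNReal.ofReal q.1⁻¹ * gammaPDF β β (q.2 / q.1)) ?_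
    fun_prop
  rw [lintegral_congr_ae hsec, ← hpos, gammaMeasure, restrict_withDensity measurableSet_Ioi,
    lintegral_withDensity_eq_lintegral_mul _ (measurable_gammaPDF α α) hmi]
  simp only [Pi.mul_apply]
  have hin : ∀ p, gammaPDF α α p * ∫⁻ x in s, ENNReal.ofReal p⁻¹ * gammaPDF β β (x / p) =
      ∫⁻ x in s, gammaPDF α α p * (ENNReal.ofReal p⁻¹ * gammaPDF β β (x / p)) := fun p => by
    rw [lintegral_const_mul (gammaPDF α α p) (by fun_prop)]
  simp_rw [hin]
  rw [lintegral_lintegral_swap hm.aemeasurable]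
  refine lintegral_congr_ae (ae_restrict_of_ae ?_)
  have h0 : ∀ᵐ x : ℝ, x ≠ 0 := by simp [ae_iff]
  filter_upwards [h0] with x hx
  rcases lt_or_gt_of_ne hx with hx | hx
  · rw [gammaGammaPDF, indicator_of_notMem (by simpa using hx.le), ENNReal.ofReal_zero, eq_comm,
      setLIntegral_congr_fun (g := fun _ => 0) measurableSet_Ioi, lintegral_zero]
    intro p (hp : 0 < p)
    simp [gammaPDF_of_neg (div_neg_of_neg_of_pos hx hp)]
  · exact (lintegral_gammaPDF_mul_gammaPDF_div hα hβ hx).symm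

/-! ### The law of the pointing error -/

lemma hasSum_besselI0 (x : ℝ) :
    HasSum (fun k : ℕ => (x / 2) ^ (2 * k) / (k.factorial : ℝ) ^ 2) (besselI0 x) := by
  refine Summable.hasSum ?_
  refine Summable.of_nonneg_of_le (fun k => ?_) (fun k => ?_)
    (Real.summable_pow_div_factorial ((x / 2) ^ 2))
  · rw [pow_mul]; positivity
  · rw [pow_mul]
    have h1 : (1 : ℝ) ≤ k.factorial := by exact_mod_cast k.factorial_pos
    gcongr
    nlinarith

lemma centralBinom_div_factorial (k : ℕ) :
    (Nat.choose (2 * k) k : ℝ) / ((2 * k).factorial : ℝ) = 1 / (k.factorial : ℝ) ^ 2 := by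
  have h := Nat.choose_mul_factorial_mul_factorial (n := 2 * k) (k := k) (by omega)
  rw [show 2 * k - k = k by omega] at h
  have h1 : (k.factorial : ℝ) ≠ 0 := by exact_mod_cast k.factorial_ne_zero
  rw [← h]
  have h2 : (Nat.choose (2 * k) k : ℝ) ≠ 0 := by
    exact_mod_cast (Nat.choose_pos (by omega)).ne'
  push_cast
  field_simp

/-- The weight of the `k`-th component in the decomposition of the law of `-log (h_g / A₀)` as a
mixture of gamma laws of shape `2k + 1` and rate `c`. -/
noncomputable def gammaMixtureWeight (ω c v : ℝ) (k : ℕ) : ℝ :=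
  ω * Nat.choose (2 * k) k * (v / 2) ^ (2 * k) / c ^ (2 * k + 1)

lemma gammaMixtureWeight_nonneg {ω c : ℝ} (hω : 0 < ω) (hc : 0 < c) (v : ℝ) (k : ℕ) :
    0 ≤ gammaMixtureWeight ω c v k := by
  rw [gammaMixtureWeight, pow_mul]
  positivity

lemma hasSum_gammaMixture {ω c v t : ℝ} (hc : 0 < c) (ht : 0 ≤ t) :
    HasSum (fun k : ℕ => gammaMixtureWeight ω c v k * gammaPDFReal (2 * k + 1 : ℕ) c t)
      (ω * Real.exp (-(c * t)) * besselI0 (v * t)) := by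
  refine ((hasSum_besselI0 (v * t)).mul_left (ω * Real.exp (-(c * t)))).congr_fun fun k => ?_
  rw [gammaMixtureWeight, gammaPDFReal, if_pos ht, Real.rpow_natCast, Nat.cast_succ,
    add_sub_cancel_right, Real.rpow_natCast, Real.Gamma_nat_eq_factorial]
  have h1 := centralBinom_div_factorial k
  have h2 : ((2 * k).factorial : ℝ) ≠ 0 := by exact_mod_cast (2 * k).factorial_ne_zero
  rw [div_eq_iff h2] at h1
  rw [h1, mul_div_right_comm v t, mul_pow]
  field_simp

/-- The mixture of gamma laws followed by `-log (h_g / A₀)`. -/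
noncomputable def gammaMixture (ω c v : ℝ) : Measure ℝ :=
  Measure.sum fun k : ℕ =>
    ENNReal.ofReal (gammaMixtureWeight ω c v k) • gammaMeasure (2 * k + 1 : ℕ) c

/-- Expanding `I₀` exhibits `h_g` as `A₀ e⁻ᵀ` with `T` distributed as a mixture of gamma laws. -/
lemma withDensity_pointingErrorPDF {ω q A₀ c v : ℝ} (hω : 0 < ω) (hA₀ : 0 < A₀)
    (hc0 : 0 < c) (hc : c = (1 + q ^ 2) * ω / (2 * q)) (hv : v = (1 - q ^ 2) * ω / (2 * q)) :
    volume.withDensity (fun x => ENNReal.ofReal (pointingErrorPDF ω q A₀ x)) =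
      (gammaMixture ω c v).map fun t => A₀ * Real.exp (-t) := by
  set f : ℝ → ℝ := fun t => A₀ * Real.exp (-t) with hf
  have hfm : Measurable f := by fun_prop
  have hfd : ∀ t ∈ Ici (0 : ℝ), HasDerivWithinAt f (A₀ * (Real.exp (-t) * -1)) (Ici 0) t :=
    fun t _ => (((hasDerivAt_neg t).exp).const_mul A₀).hasDerivWithinAt
  have hinj : InjOn f (Ici 0) := fun x _ y _ hxy =>
    neg_injective (Real.exp_injective (mul_left_cancel₀ hA₀.ne' hxy))
  have himg : f '' Ici 0 = Ioc 0 A₀ := by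
    ext x
    constructor
    · rintro ⟨t, ht, rfl⟩
      exact ⟨by positivity,
        mul_le_of_le_one_right hA₀.le (Real.exp_le_one_iff.2 (by simpa using ht))⟩
    · rintro ⟨hx0, hx⟩
      refine ⟨-Real.log (x / A₀), ?_, ?_⟩
      · have := Real.log_nonpos (by positivity) ((div_le_one hA₀).2 hx)
        simpa using this
      · simp only [hf, neg_neg]
        rw [Real.exp_log (by positivity), mul_div_cancel₀ _ hA₀.ne']
  ext s hs
  have hpre := hs.preimage hfm
  have hpdf : (fun x => ENNReal.ofReal (pointingErrorPDF ω q A₀ x)) =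
      (Ioc 0 A₀).indicator fun x => ENNReal.ofReal (pointingErrorPDF ω q A₀ x) := by
    ext x
    by_cases hx : x ∈ Ioc 0 A₀
    · rw [indicator_of_mem hx]
    · rw [indicator_of_notMem hx, pointingErrorPDF, indicator_of_notMem hx, ENNReal.ofReal_zero]
  rw [withDensity_apply _ hs, Measure.map_apply hfm hs, gammaMixture, Measure.sum_apply _ hpre,
    hpdf, ← lintegral_indicator hs, indicator_indicator, inter_comm, ← indicator_indicator,
    lintegral_indicator measurableSet_Ioc, ← himg,
    lintegral_image_eq_lintegral_abs_deriv_mul measurableSet_Ici hfd hinj]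
  have hterm : ∀ k : ℕ, (ENNReal.ofReal (gammaMixtureWeight ω c v k) •
      gammaMeasure (2 * k + 1 : ℕ) c) (f ⁻¹' s) = ∫⁻ t, (f ⁻¹' s).indicator (fun t =>
        ENNReal.ofReal (gammaMixtureWeight ω c v k) * gammaPDF (2 * k + 1 : ℕ) c t) t := by
    intro k
    rw [lintegral_indicator hpre, lintegral_const_mul _ (by fun_prop), Measure.smul_apply,
      gammaMeasure, withDensity_apply _ hpre, smul_eq_mul]
  simp_rw [hterm]
  rw [← lintegral_tsum fun k => (Measurable.indicator (by fun_prop) hpre).aemeasurable,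
    ← lintegral_indicator measurableSet_Ici]
  refine lintegral_congr fun t => ?_
  by_cases ht : 0 ≤ t
  swap
  · rw [indicator_of_notMem (by simpa using ht), eq_comm, ENNReal.tsum_eq_zero]
    intro k
    rw [indicator_apply_eq_zero]
    intro _
    rw [gammaPDF_of_neg (not_le.1 ht), mul_zero]
  rw [indicator_of_mem (mem_Ici.2 ht)]
  by_cases hts : f t ∈ s
  swap
  · simp [indicator, hts]
  simp_rw [indicator_of_mem hts, indicator_of_mem (show t ∈ f ⁻¹' s from hts)]
  have hS := hasSum_gammaMixture (ω := ω) (v := v) hc0 ht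
  have hnn : ∀ k : ℕ, 0 ≤ gammaMixtureWeight ω c v k * gammaPDFReal (2 * k + 1 : ℕ) c t :=
    fun k => mul_nonneg (gammaMixtureWeight_nonneg hω hc0 v k)
      (gammaPDFReal_nonneg (by positivity) hc0 t)
  have hsum : ∑' k : ℕ, ENNReal.ofReal (gammaMixtureWeight ω c v k) *
      gammaPDF (2 * k + 1 : ℕ) c t =
      ENNReal.ofReal (ω * Real.exp (-(c * t)) * besselI0 (v * t)) := by
    rw [← hS.tsum_eq, ENNReal.ofReal_tsum_of_nonneg hnn hS.summable]
    refine tsum_congr fun k => ?_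
    rw [gammaPDF, ENNReal.ofReal_mul (gammaMixtureWeight_nonneg hω hc0 v k)]
  have hft : f t ∈ Ioc 0 A₀ := himg ▸ mem_image_of_mem f ht
  have hdiv : f t / A₀ = Real.exp (-t) := by rw [hf]; field_simp
  rw [hsum, ← ENNReal.ofReal_mul (abs_nonneg _), pointingErrorPDF, indicator_of_mem hft, hdiv,
    Real.log_exp, ← hc, ← hv, neg_mul_neg, ← Real.exp_mul, mul_neg_one, mul_neg, abs_neg,
    abs_of_pos (by positivity)]
  congr 1
  have : Real.exp (-(c * t)) = Real.exp (-t) * Real.exp (-t * (c - 1)) := by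
    rw [← Real.exp_add]; ring_nf
  rw [this]
  field_simp

/-! ### Products of independent positive variables -/

lemma ae_pos_mconv {μ ν : Measure ℝ} [SFinite μ] [SFinite ν] (hμ : ∀ᵐ x ∂μ, 0 < x)
    (hν : ∀ᵐ x ∂ν, 0 < x) : ∀ᵐ x ∂(μ ∗ₘ ν), 0 < x := by
  rw [Measure.mconv, ae_map_iff (by fun_prop) measurableSet_Ioi]
  filter_upwards [Measure.quasiMeasurePreserving_fst.ae hμ,
    Measure.quasiMeasurePreserving_snd.ae hν] with p h1 h2 using mul_pos h1 h2

lemma integrable_rpow_mconv {μ ν : Measure ℝ} [SFinite μ] [SFinite ν] (hμ : ∀ᵐ x ∂μ, 0 < x)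
    (hν : ∀ᵐ x ∂ν, 0 < x) {r : ℝ} (h1 : Integrable (fun x : ℝ => x ^ r) μ)
    (h2 : Integrable (fun x : ℝ => x ^ r) ν) : Integrable (fun x : ℝ => x ^ r) (μ ∗ₘ ν) := by
  rw [Measure.mconv, integrable_map_measure
    (by fun_prop) (by fun_prop)]
  refine (h1.mul_prod h2).congr ?_
  filter_upwards [Measure.quasiMeasurePreserving_fst.ae hμ,
    Measure.quasiMeasurePreserving_snd.ae hν] with p h1 h2
  simp [Real.mul_rpow h1.le h2.le]

lemma integral_cpow_mconv {μ ν : Measure ℝ} [SFinite μ] [SFinite ν] (hμ : ∀ᵐ x ∂μ, 0 < x)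
    (hν : ∀ᵐ x ∂ν, 0 < x) (s : ℂ) :
    ∫ x, (x : ℂ) ^ s ∂(μ ∗ₘ ν) = (∫ x, (x : ℂ) ^ s ∂μ) * ∫ x, (x : ℂ) ^ s ∂ν := by
  rw [Measure.mconv, integral_map (by fun_prop)
    (by fun_prop : Measurable fun x : ℝ => (x : ℂ) ^ s).aestronglyMeasurable, ← integral_prod_mul]
  refine integral_congr_ae ?_
  filter_upwards [Measure.quasiMeasurePreserving_fst.ae hμ,
    Measure.quasiMeasurePreserving_snd.ae hν] with p h1 h2
  simp only [Complex.ofReal_mul, Complex.mul_cpow_ofReal_nonneg h1.le h2.le]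

lemma mconv_singleton_eq_zero {μ ν : Measure ℝ} [SFinite μ] [SFinite ν] [NullSingletonClass μ]
    (hν : ∀ᵐ x ∂ν, 0 < x) (x : ℝ) : (μ ∗ₘ ν) {x} = 0 := by
  rw [Measure.mconv, Measure.map_apply (by fun_prop) (measurableSet_singleton x),
    Measure.prod_apply_symm ((measurableSet_singleton x).preimage (by fun_prop)),
    lintegral_eq_zero_iff' (measurable_measure_prodMk_right
      ((measurableSet_singleton x).preimage (by fun_prop))).aemeasurable]
  filter_upwards [hν] with y hy
  refine measure_mono_null (t := {x / y}) (fun z hz => ?_) (measure_singleton _)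
  have hz : z * y = x := hz
  simp [← hz, hy.ne']

/-! ### The law of a Gamma-Gamma variable times `e⁻ᵀ` -/

/-- The Gamma-Gamma law of shape parameters `α` and `β`. -/
noncomputable def gammaGammaMeasure (α β : ℝ) : Measure ℝ :=
  gammaMeasure α α ∗ₘ gammaMeasure β β

/-- The law of `e⁻ᵀ` for a gamma variable `T` of shape `n` and rate `c`. -/
noncomputable def expNegGammaMeasure (n : ℕ) (c : ℝ) : Measure ℝ :=
  (gammaMeasure n c).map fun t => Real.exp (-t)

lemma isProbabilityMeasure_gammaGammaMeasure {α β : ℝ} (hα : 0 < α) (hβ : 0 < β) :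
    IsProbabilityMeasure (gammaGammaMeasure α β) := by
  have := isProbabilityMeasure_gammaMeasure hα hα
  have := isProbabilityMeasure_gammaMeasure hβ hβ
  rw [gammaGammaMeasure]
  infer_instance

lemma isProbabilityMeasure_expNegGammaMeasure {n : ℕ} (hn : 0 < n) {c : ℝ} (hc : 0 < c) :
    IsProbabilityMeasure (expNegGammaMeasure n c) := by
  have := isProbabilityMeasure_gammaMeasure (a := n) (by exact_mod_cast hn) hc
  exact Measure.isProbabilityMeasure_map (by fun_prop)

lemma nullSingletonClass_gammaGammaMeasure {α β : ℝ} (hα : 0 < α) (hβ : 0 < β) :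
    NullSingletonClass (gammaGammaMeasure α β) := by
  rw [gammaGammaMeasure, ← withDensity_gammaGammaPDF hα hβ]
  infer_instance

lemma ae_pos_gammaGammaMeasure {α β : ℝ} (hα : 0 < α) (hβ : 0 < β) :
    ∀ᵐ x ∂gammaGammaMeasure α β, 0 < x := by
  have := isProbabilityMeasure_gammaMeasure hα hα
  have := isProbabilityMeasure_gammaMeasure hβ hβ
  exact ae_pos_mconv (ae_pos_gammaMeasure α α) (ae_pos_gammaMeasure β β)

lemma ae_pos_expNegGammaMeasure (n : ℕ) (c : ℝ) : ∀ᵐ x ∂expNegGammaMeasure n c, 0 < x := by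
  rw [expNegGammaMeasure, ae_map_iff (by fun_prop) measurableSet_Ioi]
  exact ae_of_all _ fun t => Real.exp_pos _

lemma integrable_rpow_neg_gammaGammaMeasure {α β ψ : ℝ} (hα : 0 < α) (hβ : 0 < β)
    (h1 : ψ < α) (h2 : ψ < β) :
    Integrable (fun x : ℝ => x ^ (-ψ)) (gammaGammaMeasure α β) := by
  have := isProbabilityMeasure_gammaMeasure hα hα
  have := isProbabilityMeasure_gammaMeasure hβ hβ
  exact integrable_rpow_mconv (ae_pos_gammaMeasure α α) (ae_pos_gammaMeasure β β)
    (integrable_rpow_neg_gammaMeasure hα hα h1) (integrable_rpow_neg_gammaMeasure hβ hβ h2)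

lemma integrable_rpow_neg_expNegGammaMeasure {n : ℕ} (hn : 0 < n) {c ψ : ℝ} (hc : 0 < c)
    (hψ : ψ < c) : Integrable (fun x : ℝ => x ^ (-ψ)) (expNegGammaMeasure n c) := by
  rw [expNegGammaMeasure, integrable_map_measure (by fun_prop) (by fun_prop)]
  refine (integrable_exp_gammaMeasure (by exact_mod_cast hn) hc hψ).congr (ae_of_all _ fun t => ?_)
  simp [← Real.exp_mul, mul_comm]

lemma integral_cpow_neg_gammaGammaMeasure {α β : ℝ} (hα : 0 < α) (hβ : 0 < β) {s : ℂ}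
    (h1 : s.re < α) (h2 : s.re < β) :
    ∫ x, (x : ℂ) ^ (-s) ∂gammaGammaMeasure α β =
      ((α : ℂ) ^ s * Complex.Gamma (α - s) / Real.Gamma α) *
        ((β : ℂ) ^ s * Complex.Gamma (β - s) / Real.Gamma β) := by
  have := isProbabilityMeasure_gammaMeasure hα hα
  have := isProbabilityMeasure_gammaMeasure hβ hβ
  rw [gammaGammaMeasure, integral_cpow_mconv (ae_pos_gammaMeasure α α) (ae_pos_gammaMeasure β β),
    integral_cpow_neg_gammaMeasure hα hα h1, integral_cpow_neg_gammaMeasure hβ hβ h2]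

lemma integral_cpow_neg_expNegGammaMeasure (n : ℕ) {c : ℝ} (hc : 0 < c) {s : ℂ}
    (hs : s.re < c) :
    ∫ x, (x : ℂ) ^ (-s) ∂expNegGammaMeasure (n + 1) c = (c / (c - s)) ^ (n + 1) := by
  rw [expNegGammaMeasure, integral_map (by fun_prop)
    (by fun_prop : Measurable fun x : ℝ => (x : ℂ) ^ (-s)).aestronglyMeasurable,
    ← integral_cexp_gammaMeasure n hc hs]
  refine integral_congr_ae (ae_of_all _ fun t => ?_)
  simp only
  rw [Complex.cpow_def_of_ne_zero (by exact_mod_cast (Real.exp_pos _).ne'),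
    ← Complex.ofReal_log (Real.exp_pos _).le, Real.log_exp]
  congr 1
  push_cast
  ring

lemma mul_sqrt_one_add_sq_le_norm {d : ℝ} (hd : 0 < d) (hd1 : d ≤ 1) {z : ℂ} (hdz : d ≤ |z.re|) :
    d * Real.sqrt (1 + z.im ^ 2) ≤ ‖z‖ := by
  rw [← abs_of_pos hd, ← Real.sqrt_sq_eq_abs, ← Real.sqrt_mul (sq_nonneg d),
    ← Real.sqrt_sq (norm_nonneg z), Complex.sq_norm, Complex.normSq_apply]
  refine Real.sqrt_le_sqrt ?_
  have h2 : d ^ 2 ≤ z.re ^ 2 := by rw [← sq_abs z.re]; gcongr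
  have h3 : d ^ 2 ≤ 1 := pow_le_one₀ hd.le hd1
  nlinarith [mul_le_mul_of_nonneg_right h3 (sq_nonneg z.im)]

/-- On a vertical line the Mellin transform of the cumulative distribution function decays
quadratically: one factor `1 / |t|` comes from `1 / s`, another from `c / (c - s)`, and the moments
of the Gamma-Gamma law are bounded. -/
lemma integrable_mellin_gammaGamma_mconv {α β c ψ : ℝ} (hα : 0 < α) (hβ : 0 < β) (hc : 0 < c)
    (n : ℕ) (hψ : 0 < ψ) (hψc : ψ < c) :
    Integrable fun t : ℝ => (∫ u, (u : ℂ) ^ (-(ψ + t * Complex.I))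
      ∂(gammaGammaMeasure α β ∗ₘ expNegGammaMeasure (n + 1) c)) / (ψ + t * Complex.I) := by
  have := isProbabilityMeasure_gammaGammaMeasure hα hβ
  have := isProbabilityMeasure_expNegGammaMeasure n.succ_pos hc
  set B := ∫ x, x ^ (-ψ) ∂gammaGammaMeasure α β
  set d := min (min ψ (c - ψ)) 1
  have hd : 0 < d := lt_min (lt_min hψ (by linarith)) one_pos
  have hd1 : d ≤ 1 := min_le_right _ _
  have hdψ : d ≤ ψ := (min_le_left _ _).trans (min_le_left _ _)
  have hdc : d ≤ c - ψ := (min_le_left _ _).trans (min_le_right _ _)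
  have hmeas : AEStronglyMeasurable (fun t : ℝ => (∫ u, (u : ℂ) ^ (-(ψ + t * Complex.I))
      ∂(gammaGammaMeasure α β ∗ₘ expNegGammaMeasure (n + 1) c)) / (ψ + t * Complex.I)) := by
    have h : Measurable fun p : ℝ × ℝ => (p.2 : ℂ) ^ (-(ψ + p.1 * Complex.I)) := by fun_prop
    exact (h.stronglyMeasurable.integral_prod_right.measurable.div
      (by fun_prop)).aestronglyMeasurable
  refine (integrable_inv_one_add_sq.const_mul (B * (c / d) ^ n * (c / d ^ 2))).mono' hmeas
    (ae_of_all _ fun t => ?_)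
  set s : ℂ := ψ + t * Complex.I with hs
  have hsre : s.re = ψ := by simp [hs]
  have hsim : s.im = t := by simp [hs]
  have hB : ‖∫ x, (x : ℂ) ^ (-s) ∂gammaGammaMeasure α β‖ ≤ B := by
    refine (norm_integral_le_integral_norm _).trans_eq (integral_congr_ae ?_)
    filter_upwards [ae_pos_gammaGammaMeasure hα hβ] with x hx
    rw [Complex.norm_cpow_eq_rpow_re_of_pos hx, Complex.neg_re, hsre]
  have hB0 : 0 ≤ B := (norm_nonneg _).trans hB
  have hn1 : d * Real.sqrt (1 + t ^ 2) ≤ ‖s‖ := by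
    have := mul_sqrt_one_add_sq_le_norm hd hd1 (z := s) (hsre ▸ hdψ.trans (le_abs_self _))
    rwa [hsim] at this
  have hn2 : d * Real.sqrt (1 + t ^ 2) ≤ ‖(c : ℂ) - s‖ := by
    have := mul_sqrt_one_add_sq_le_norm hd hd1 (z := c - s)
      (by simpa [hsre] using hdc.trans (le_abs_self _))
    simpa [hsim] using this
  have hr : 1 ≤ Real.sqrt (1 + t ^ 2) := Real.one_le_sqrt.2 (by nlinarith [sq_nonneg t])
  have hn3 : d ≤ ‖(c : ℂ) - s‖ := (le_mul_of_one_le_right hd.le hr).trans hn2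
  rw [integral_cpow_mconv (ae_pos_gammaGammaMeasure hα hβ) (ae_pos_expNegGammaMeasure _ c),
    integral_cpow_neg_expNegGammaMeasure n hc (by rwa [hsre]), pow_succ, norm_div, norm_mul,
    norm_mul, norm_pow, norm_div, Complex.norm_real, Real.norm_of_nonneg hc.le]
  calc _ ≤ B * ((c / d) ^ n * (c / (d * Real.sqrt (1 + t ^ 2)))) /
        (d * Real.sqrt (1 + t ^ 2)) := by gcongr
    _ = B * (c / d) ^ n * (c / d ^ 2) * (Real.sqrt (1 + t ^ 2) ^ 2)⁻¹ := by
      field_simp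
    _ = _ := by rw [Real.sq_sqrt (by positivity)]

/-! ### The Meijer functions -/

lemma meijerSeparates_iff {α β c ψ : ℝ} (k : ℕ) :
    MeijerSeparates (2 * k + 3) 1 (1 :: List.replicate (2 * k + 1) ((c : ℂ) + 1))
      ((α : ℂ) :: (β : ℂ) :: (List.replicate (2 * k + 1) (c : ℂ) ++ [0])) ψ ↔
      0 < ψ ∧ ψ < α ∧ ψ < β ∧ ψ < c := by
  have hm : 2 * k + 3 = (2 * k + 1) + 1 + 1 := rfl
  have htake : (List.replicate (2 * k + 1) (c : ℂ) ++ [0]).take (2 * k + 1) =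
      List.replicate (2 * k + 1) (c : ℂ) := List.take_left' (by simp)
  rw [MeijerSeparates, hm, List.take_succ_cons, List.take_succ_cons, htake]
  simp
  tauto

/-- All gamma quotients of the integrand collapse: `Γ(s) / Γ(1 + s) = 1 / s` and
`Γ(c - s) / Γ(c + 1 - s) = 1 / (c - s)`. -/
lemma meijerIntegrand_eq (α β c z : ℂ) (k : ℕ) {s : ℂ} (hs : s ≠ 0) (hΓs : Complex.Gamma s ≠ 0)
    (hcs : c - s ≠ 0) (hΓcs : Complex.Gamma (c - s) ≠ 0) :
    meijerIntegrand (2 * k + 3) 1 (1 :: List.replicate (2 * k + 1) (c + 1))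
      (α :: β :: (List.replicate (2 * k + 1) c ++ [0])) z s =
      Complex.Gamma (α - s) * Complex.Gamma (β - s) / (s * (c - s) ^ (2 * k + 1)) * z ^ s := by
  have hm : 2 * k + 3 = (2 * k + 1) + 1 + 1 := rfl
  have htake : (List.replicate (2 * k + 1) c ++ [0]).take (2 * k + 1) =
      List.replicate (2 * k + 1) c := List.take_left' (by simp)
  have hdrop : (List.replicate (2 * k + 1) c ++ [0]).drop (2 * k + 1) = [0] :=
    List.drop_left' (by simp)
  have h1 : Complex.Gamma (c + 1 - s) = (c - s) * Complex.Gamma (c - s) := by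
    rw [← Complex.Gamma_add_one _ hcs]; ring_nf
  have h2 : Complex.Gamma (1 + s) = s * Complex.Gamma s := by
    rw [← Complex.Gamma_add_one _ hs]; ring_nf
  rw [meijerIntegrand, hm, List.take_succ_cons, List.take_succ_cons, htake, List.drop_succ_cons,
    List.drop_succ_cons, hdrop]
  simp only [List.map_cons, List.map_replicate, List.prod_cons, List.prod_replicate,
    List.take_succ_cons, List.take_zero, List.map_nil, List.prod_nil, List.drop_succ_cons,
    List.drop_zero, sub_self, zero_add, sub_zero, mul_one, h1, h2, mul_pow]
  field_simp

lemma ofReal_mul_mul_cpow {α β x : ℝ} (hα : 0 ≤ α) (hβ : 0 ≤ β) (hx : 0 ≤ x) (s : ℂ) :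
    ((α * β * x : ℝ) : ℂ) ^ s = (α : ℂ) ^ s * (β : ℂ) ^ s * (x : ℂ) ^ s := by
  push_cast
  rw [← Complex.ofReal_mul, Complex.mul_cpow_ofReal_nonneg (mul_nonneg hα hβ) hx,
    Complex.ofReal_mul, Complex.mul_cpow_ofReal_nonneg hα hβ]

/-- The Meijer functions of the expansion are, up to a constant, distribution functions of products
of a Gamma-Gamma variable and an independent `e⁻ᵀ` with `T` of gamma law. -/
lemma hasMeijerG_gammaGamma {α β c x : ℝ} (hα : 0 < α) (hβ : 0 < β) (hc : 0 < c) (hx : 0 < x)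
    (k : ℕ) :
    HasMeijerG (2 * k + 3) 1 (1 :: List.replicate (2 * k + 1) ((c : ℂ) + 1))
      ((α : ℂ) :: (β : ℂ) :: (List.replicate (2 * k + 1) (c : ℂ) ++ [0]))
      ((α * β * x : ℝ) : ℂ)
      ((Real.Gamma α * Real.Gamma β / c ^ (2 * k + 1) *
        (gammaGammaMeasure α β ∗ₘ expNegGammaMeasure (2 * k + 1) c).real (Iic x) : ℝ) : ℂ) := by
  have := isProbabilityMeasure_gammaGammaMeasure hα hβ
  have := isProbabilityMeasure_expNegGammaMeasure (2 * k).succ_pos hc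
  have := nullSingletonClass_gammaGammaMeasure hα hβ
  have hposG := ae_pos_gammaGammaMeasure hα hβ
  have hposE := ae_pos_expNegGammaMeasure (2 * k + 1) c
  set τ := gammaGammaMeasure α β ∗ₘ expNegGammaMeasure (2 * k + 1) c with hτ
  have hc0 : (c : ℂ) ≠ 0 := by exact_mod_cast hc.ne'
  have hΓα : (Real.Gamma α : ℂ) ≠ 0 := by exact_mod_cast (Real.Gamma_pos_of_pos hα).ne'
  have hΓβ : (Real.Gamma β : ℂ) ≠ 0 := by exact_mod_cast (Real.Gamma_pos_of_pos hβ).ne'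
  constructor
  · refine ⟨min α (min β c) / 2, (meijerSeparates_iff k).2 ?_⟩
    have h0 : 0 < min α (min β c) := lt_min hα (lt_min hβ hc)
    have h1 : min α (min β c) ≤ α := min_le_left _ _
    have h2 : min α (min β c) ≤ β := (min_le_right _ _).trans (min_le_left _ _)
    have h3 : min α (min β c) ≤ c := (min_le_right _ _).trans (min_le_right _ _)
    refine ⟨?_, ?_, ?_, ?_⟩ <;> linarith
  intro ψ hsep
  obtain ⟨hψ, hψα, hψβ, hψc⟩ := (meijerSeparates_iff k).1 hsep
  set C : ℂ := Real.Gamma α * Real.Gamma β / c ^ (2 * k + 1) with hC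
  have hkey : ∀ t : ℝ, meijerIntegrand (2 * k + 3) 1
      (1 :: List.replicate (2 * k + 1) ((c : ℂ) + 1))
      ((α : ℂ) :: (β : ℂ) :: (List.replicate (2 * k + 1) (c : ℂ) ++ [0]))
      ((α * β * x : ℝ) : ℂ) (ψ + t * Complex.I) =
      C * ((∫ u, (u : ℂ) ^ (-(ψ + t * Complex.I)) ∂τ) / (ψ + t * Complex.I) *
        (x : ℂ) ^ (ψ + t * Complex.I)) := by
    intro t
    set s : ℂ := ψ + t * Complex.I with hs
    have hsre : s.re = ψ := by simp [hs]
    have hcsre : 0 < ((c : ℂ) - s).re := by simpa [hsre] using hψc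
    have hs0 : s ≠ 0 := fun h => by rw [h] at hsre; simp at hsre; linarith
    have hcs0 : (c : ℂ) - s ≠ 0 := fun h => by rw [h] at hcsre; simp at hcsre
    rw [meijerIntegrand_eq _ _ _ _ _ hs0 (Complex.Gamma_ne_zero_of_re_pos (by rwa [hsre])) hcs0
      (Complex.Gamma_ne_zero_of_re_pos hcsre), ofReal_mul_mul_cpow hα.le hβ.le hx.le, hτ,
      integral_cpow_mconv hposG hposE,
      integral_cpow_neg_gammaGammaMeasure hα hβ (by rwa [hsre]) (by rwa [hsre]),
      integral_cpow_neg_expNegGammaMeasure (2 * k) hc (by rwa [hsre]), hC, div_pow]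
    field_simp
  have hV := integrable_mellin_gammaGamma_mconv hα hβ hc (2 * k) hψ hψc
  have hxs : Measurable fun t : ℝ => (x : ℂ) ^ (ψ + t * Complex.I) := by fun_prop
  have hI := (hV.mul_bdd (c := x ^ ψ) hxs.aestronglyMeasurable (ae_of_all _ fun t => by
    rw [Complex.norm_cpow_eq_rpow_re_of_pos hx]; simp)).const_mul C
  have hinv := integral_mellin_eq_measureReal_Iic (τ := τ) (ae_pos_mconv hposG hposE) hx hψ
    (mconv_singleton_eq_zero hposE x)
    (integrable_rpow_mconv hposG hposE (integrable_rpow_neg_gammaGammaMeasure hα hβ hψα hψβ)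
      (integrable_rpow_neg_expNegGammaMeasure (2 * k).succ_pos hc hψc)) hV
  refine ⟨hI.congr (ae_of_all _ fun t => (hkey t).symm), ?_⟩
  simp_rw [hkey]
  rw [integral_mul_const, integral_const_mul]
  push_cast
  rw [← hC, ← hinv]
  have hπ : (Real.pi : ℂ) ≠ 0 := by exact_mod_cast Real.pi_ne_zero
  field_simp

/-! ### The end-to-end distribution -/

lemma lintegral_measure_mul_exp_neg_le {μ : Measure ℝ} [SFinite μ] {n : ℕ} (hn : 0 < n)
    {c a h : ℝ} (hc : 0 < c) (ha : 0 < a) :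
    ∫⁻ t, μ {y | a * y * Real.exp (-t) ≤ h} ∂gammaMeasure n c =
      (μ ∗ₘ expNegGammaMeasure n c) (Iic (h / a)) := by
  have := isProbabilityMeasure_gammaMeasure (a := n) (by exact_mod_cast hn) hc
  have := isProbabilityMeasure_expNegGammaMeasure hn hc
  have hS : MeasurableSet ((fun p : ℝ × ℝ => p.1 * p.2) ⁻¹' Iic (h / a)) :=
    measurableSet_Iic.preimage (by fun_prop)
  rw [Measure.mconv, Measure.map_apply (by fun_prop) measurableSet_Iic,
    Measure.prod_apply_symm hS, expNegGammaMeasure,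
    lintegral_map (measurable_measure_prodMk_right hS) (by fun_prop)]
  refine lintegral_congr fun t => ?_
  congr 1
  ext y
  simp only [mem_ofPred_eq, mem_preimage, mem_Iic]
  rw [le_div_iff₀ ha]
  ring_nf

end

theorem theorem2 {Ω : Type*} [MeasurableSpace Ω] (P : Measure Ω) [IsProbabilityMeasure P]
    (α β ω q A₀ hl : ℝ) (hα : 0 < α) (hβ : 0 < β) (hω : 0 < ω) (hq : 0 < q)
    (hA₀ : 0 < A₀) (hhl : 0 < hl)
    (hs hg : Ω → ℝ)
    (hs_density : HasDensity hs P (gammaGammaPDF α β))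
    (hg_density : HasDensity hg P (pointingErrorPDF ω q A₀))
    (h_indep : IndepFun hs hg P)
    (c v : ℝ) (hc : c = (1 + q ^ 2) * ω / (2 * q)) (hv : v = (1 - q ^ 2) * ω / (2 * q))
    (a b : ℕ → List ℂ)
    (ha : ∀ k, a k = 1 :: List.replicate (2 * k + 1) ((c : ℂ) + 1))
    (hb : ∀ k, b k = (α : ℂ) :: (β : ℂ) :: (List.replicate (2 * k + 1) (c : ℂ) ++ [0]))
    (h : ℝ) (hh : 0 < h) :
    (∀ k : ℕ, ∃ w : ℂ,
      HasMeijerG (2 * k + 3) 1 (a k) (b k) ((α * β * h / (A₀ * hl) : ℝ) : ℂ) w) ∧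
    Summable (fun k : ℕ => (Nat.choose (2 * k) k : ℂ) * ((v : ℂ) / 2) ^ (2 * k) *
      meijerG (2 * k + 3) 1 (a k) (b k) ((α * β * h / (A₀ * hl) : ℝ) : ℂ)) ∧
    ((cdf (P.map fun x => hl * hs x * hg x) h : ℝ) : ℂ) =
      ((ω / (Real.Gamma α * Real.Gamma β) : ℝ) : ℂ) *
        ∑' k : ℕ, (Nat.choose (2 * k) k : ℂ) * ((v : ℂ) / 2) ^ (2 * k) *
          meijerG (2 * k + 3) 1 (a k) (b k) ((α * β * h / (A₀ * hl) : ℝ) : ℂ) := by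
  have hc0 : 0 < c := by rw [hc]; positivity
  have hAl : 0 < A₀ * hl := mul_pos hA₀ hhl
  have hΓα := Real.Gamma_pos_of_pos hα
  have hΓβ := Real.Gamma_pos_of_pos hβ
  have := isProbabilityMeasure_gammaGammaMeasure hα hβ
  set τ : ℕ → Measure ℝ := fun k => gammaGammaMeasure α β ∗ₘ expNegGammaMeasure (2 * k + 1) c
    with hτ
  have hG : ∀ k, HasMeijerG (2 * k + 3) 1 (a k) (b k) ((α * β * h / (A₀ * hl) : ℝ) : ℂ)
      ((Real.Gamma α * Real.Gamma β / c ^ (2 * k + 1) *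
        (τ k).real (Set.Iic (h / (A₀ * hl))) : ℝ) : ℂ) := fun k => by
    rw [ha, hb, mul_div_assoc]
    exact hasMeijerG_gammaGamma hα hβ hc0 (div_pos hh hAl) k
  have hms : P.map hs = gammaGammaMeasure α β := by
    rw [hs_density.2, withDensity_gammaGammaPDF hα hβ, gammaGammaMeasure]
  have hmg : P.map hg = (gammaMixture ω c v).map fun t => A₀ * Real.exp (-t) := by
    rw [hg_density.2, withDensity_pointingErrorPDF hω hA₀ hc0 hc hv]
  have hmeas : Measurable fun p : ℝ × ℝ => hl * p.1 * p.2 := by fun_prop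
  have hjoint : P.map (fun x => hl * hs x * hg x) =
      ((gammaGammaMeasure α β).prod (P.map hg)).map fun p => hl * p.1 * p.2 := by
    rw [← hms, ← (indepFun_iff_map_prod_eq_prod_map_map hs_density.1 hg_density.1).1 h_indep,
      AEMeasurable.map_map_of_aemeasurable hmeas.aemeasurable
        (hs_density.1.prodMk hg_density.1)]
    rfl
  have hgp : IsProbabilityMeasure (P.map hg) := Measure.isProbabilityMeasure_map hg_density.1
  have hprob : IsProbabilityMeasure (P.map fun x => hl * hs x * hg x) := by
    rw [hjoint]
    exact Measure.isProbabilityMeasure_map hmeas.aemeasurable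
  -- Conditioning on `T = -log (h_g / A₀)` decomposes the law of `h` along the gamma mixture.
  have hlaw : (P.map fun x => hl * hs x * hg x) (Set.Iic h) =
      ∑' k : ℕ, ENNReal.ofReal (gammaMixtureWeight ω c v k) * τ k (Set.Iic (h / (A₀ * hl))) := by
    have hS := measurableSet_Iic (a := h).preimage hmeas
    rw [hjoint, Measure.map_apply hmeas measurableSet_Iic, Measure.prod_apply_symm hS, hmg,
      lintegral_map (measurable_measure_prodMk_right hS) (by fun_prop), gammaMixture,
      lintegral_sum_measure]
    refine tsum_congr fun k => ?_
    rw [lintegral_smul_measure, smul_eq_mul, hτ,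
      ← lintegral_measure_mul_exp_neg_le (2 * k).succ_pos hc0 hAl]
    congr 1
    refine lintegral_congr fun t => ?_
    congr 1
    ext y
    simp only [Set.mem_preimage, Set.mem_Iic, Set.mem_ofPred_eq]
    ring_nf
  have hfin : ∑' k : ℕ, ENNReal.ofReal (gammaMixtureWeight ω c v k) *
      τ k (Set.Iic (h / (A₀ * hl))) ≠ ⊤ := hlaw ▸ measure_ne_top _ _
  have hsum := ENNReal.hasSum_toReal hfin
  rw [← ENNReal.tsum_toReal_eq (ENNReal.ne_top_of_tsum_ne_top hfin), ← hlaw,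
    ← measureReal_def, ← cdf_eq_real] at hsum
  have hterm : ∀ k : ℕ, (Nat.choose (2 * k) k : ℂ) * ((v : ℂ) / 2) ^ (2 * k) *
      meijerG (2 * k + 3) 1 (a k) (b k) ((α * β * h / (A₀ * hl) : ℝ) : ℂ) =
      ((Real.Gamma α * Real.Gamma β / ω * (ENNReal.ofReal (gammaMixtureWeight ω c v k) *
        τ k (Set.Iic (h / (A₀ * hl)))).toReal : ℝ) : ℂ) := fun k => by
    rw [(hG k).meijerG_eq, ENNReal.toReal_mul,
      ENNReal.toReal_ofReal (gammaMixtureWeight_nonneg hω hc0 v k), ← measureReal_def,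
      gammaMixtureWeight]
    norm_cast
    field_simp
  have hsum' := Complex.hasSum_ofReal.2 (hsum.mul_left (Real.Gamma α * Real.Gamma β / ω))
  refine ⟨fun k => ⟨_, hG k⟩, ?_, ?_⟩
  · simp_rw [hterm]
    exact hsum'.summable
  · simp_rw [hterm]
    rw [hsum'.tsum_eq, ← Complex.ofReal_mul]
    congr 1
    field_simp
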